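/- Let $p=(p_k)_{k\ge 2}$ satisfy $p_k\in[0,1)$, $\sum_{k\ge2}p_k=1$, $\sum_{k=2}^n p_k<1$ for every $n$, and $a:=\sum_{k\ge2}k p_k<\infty$; put $\hat p_k:=kp_k/a$. Let $s\in\{0,1,2,\dots\}$. **The random tree $\mathbf{GW}(s,p)$** is the genealogical tree of the following branching process, in which all individuals reproduce independently. An ordinary individual has $m$ children, all ordinary, with probability $p_{m+1}$. A distinguished individual has $m$ children with probability $\hat p_{m+1}$; $\min\{m,s\}$ of them are distinguished and the remaining ones are ordinary. The root $o$ is distinguished if $s\ge1$ and ordinary if $s=0$ (so $\mathbf{GW}(0,p)$ is the ordinary Galton–Watson tree). For $s\ge 1$ one may also let the root have $m$ children with probability $\hat p_m$ instead of $\hat p_{m+1}$; everything below is asserted for both versions. **The Ising model.** Let $\mathsf G=(\mathsf V,\mathsf E)$ be a realization of the tree, $\mathsf S_n$ the set of vertices at distance $n$ from $o$, $\mathsf V_n=\mathsf S_0\cup\dots\cup \mathsf S_n$, $\mathsf E_n$ the set of edges with both ends in $\mathsf V_n$, and $\mathsf E_n^b$ the set of edges $\{x,y\}$ with $x\in \mathsf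 S_n$, $y\in \mathsf S_{n+1}$. For real couplings $J_{xy}$ of arbitrary signs with $J:=\sup_{\{x,y\}\in\mathsf E}|J_{xy}|<\infty$ and an inverse temperature $\beta>0$ put $K_{xy}=\beta J_{xy}$, $K=\beta J$. For a boundary condition $\xi\in\{-1,1\}^{\mathsf V}$ let $$\pi_n(\sigma|\xi)=\frac1{Z_n(\xi)}\exp\Big(\sum_{\{x,y\}\in \mathsf E_n}(K_{xy}\sigma_x\sigma_y+K)+\sum_{\{x,y\}\in \mathsf E_n^b,\ x\in \mathsf S_n}K_{xy}\sigma_x\xi_y\Big),\qquad \sigma\in\{-1,1\}^{\mathsf V_n},$$ where $Z_n(\xi)$ is the normalizing constant, and let $M_{n,z}(\xi)=\sum_\sigma\sigma_z\pi_n(\sigma|\xi)$ be the magnetization at $z\in\mathsf V_n$. The model is in a *paramagnetic state* if $\lim_{n\to\infty}M_{n,z}(\xi)=0$ for all $z\in \mathsf V$ and all $\xi$. Set $$K_c=\tfrac14\ln\frac a{a-1},\qquad \widehat K_c=\tfrac14\ln\frac{s^{1/\alpha}+1}{s^{1/\alpha}},\qquad b=\sum_{k\ge2}kp_k\ln k,\qquad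 b_\alpha=\sum_{k\ge s+1}(k-s)^\alpha\hat p_k .$$ **Theorem.** (i) For $s=0$, with probability one (with respect to the tree), the Ising model is in a paramagnetic state for all bounded couplings and all $\beta>0$ with $K<K_c$. (ii) If $b<\infty$, the same holds for $s=1$. (iii) If $s\ge2$ and $b_\alpha<\infty$ for some $\alpha\in(0,1)$, then, with probability one, the Ising model is in a paramagnetic state for all bounded couplings and all $\beta>0$ with $K<\min\{K_c,\widehat K_c\}$, where $\widehat K_c$ is taken with this $\alpha$. -/

import Mathlib

open Filter Topology MeasureTheory

noncomputable section

/-! ### The Ising model on a rooted graph -/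

namespace Ising

/-- The sphere `S_n`: vertices at graph distance `n` from the root `o`. -/
def sphere {V : Type*} (G : SimpleGraph V) (o : V) (n : ℕ) : Set V := {x | G.dist o x = n}

/-- The ball `V_n`, the union of the spheres `S_0, …, S_n`. -/
def ball {V : Type*} (G : SimpleGraph V) (o : V) (n : ℕ) : Set V := {x | G.dist o x ≤ n}

/-- The set `E_n` of edges with both ends in `V_n`. -/
def innerEdges {V : Type*} (G : SimpleGraph V) (o : V) (n : ℕ) : Set (Sym2 V) :=
  {e | e ∈ G.edgeSet ∧ ∀ x ∈ e, x ∈ ball G o n}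

/-- The set `E_n^b` of edges between `S_n` and `S_{n+1}`. -/
def boundaryEdges {V : Type*} (G : SimpleGraph V) (o : V) (n : ℕ) : Set (Sym2 V) :=
  {e | e ∈ G.edgeSet ∧ ∃ x ∈ sphere G o n, ∃ y ∈ sphere G o (n + 1), e = s(x, y)}

open Classical in
/-- The spin configuration equal to `σ` in `V_n` and to `ξ` outside `V_n`.
Spins take values in `ℤˣ = {1, -1}`. -/
def glue {V : Type*} (G : SimpleGraph V) (o : V) (n : ℕ) (σ : ball G o n → ℤˣ) (ξ : V → ℤˣ) :
    V → ℤˣ :=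
  fun x => if h : x ∈ ball G o n then σ ⟨x, h⟩ else ξ x

/-- The product `τ_x τ_y`, as a real number, over the two ends of an edge `{x, y}`. -/
def edgeSpin {V : Type*} (τ : V → ℤˣ) : Sym2 V → ℝ :=
  Sym2.lift ⟨fun x y => ((τ x : ℤ) : ℝ) * ((τ y : ℤ) : ℝ), fun _ _ => mul_comm _ _⟩

/-- The sup over the edges of `|J_{xy}|`, multiplied by the inverse temperature `β`. -/
def couplingBound {V : Type*} (G : SimpleGraph V) (J : Sym2 V → ℝ) (β : ℝ) : ℝ :=
  β * ⨆ e : G.edgeSet, |J e|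

/-- The Boltzmann weight of the configuration `σ` in `V_n` with `ξ` fixed outside, in zero
external field, with `K_{xy} = β J_{xy}`:
`exp (∑_{E_n} (K_{xy} σ_x σ_y + K) + ∑_{E_n^b} K_{xy} σ_x ξ_y)`.
The graphs considered are locally finite, so that all the `finsum`s here and below are
finite sums. -/
def weight {V : Type*} (G : SimpleGraph V) (o : V) (J : Sym2 V → ℝ) (β : ℝ) (n : ℕ)
    (ξ : V → ℤˣ) (σ : ball G o n → ℤˣ) : ℝ :=
  Real.exp
    ((∑ᶠ e ∈ innerEdges G o n, (β * J e * edgeSpin (glue G o n σ ξ) e + couplingBound G J β)) +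
      ∑ᶠ e ∈ boundaryEdges G o n, β * J e * edgeSpin (glue G o n σ ξ) e)

/-- The partition function `Z_n(ξ)`. -/
def partitionFunction {V : Type*} (G : SimpleGraph V) (o : V) (J : Sym2 V → ℝ) (β : ℝ) (n : ℕ)
    (ξ : V → ℤˣ) : ℝ :=
  ∑ᶠ σ : ball G o n → ℤˣ, weight G o J β n ξ σ

/-- The local Gibbs distribution `π_n(σ | ξ)`. -/
def gibbs {V : Type*} (G : SimpleGraph V) (o : V) (J : Sym2 V → ℝ) (β : ℝ) (n : ℕ)
    (ξ : V → ℤˣ) (σ : ball G o n → ℤˣ) : ℝ :=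
  weight G o J β n ξ σ / partitionFunction G o J β n ξ

/-- The magnetization `M_{n,z}(ξ) = ∑_σ σ_z π_n(σ | ξ)` (of interest for `z ∈ V_n`, that is,
for all but finitely many `n`). -/
def magnetization {V : Type*} (G : SimpleGraph V) (o : V) (J : Sym2 V → ℝ) (β : ℝ) (n : ℕ)
    (ξ : V → ℤˣ) (z : V) : ℝ :=
  ∑ᶠ σ : ball G o n → ℤˣ, ((glue G o n σ ξ z : ℤ) : ℝ) * gibbs G o J β n ξ σ

/-- The model is in a paramagnetic state: for all `z` and all boundary conditions `ξ`,
`M_{n,z}(ξ) → 0`. -/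
def IsParamagnetic {V : Type*} (G : SimpleGraph V) (o : V) (J : Sym2 V → ℝ) (β : ℝ) : Prop :=
  ∀ (z : V) (ξ : V → ℤˣ), Tendsto (fun n => magnetization G o J β n ξ z) atTop (𝓝 0)

end Ising

/-! ### The random trees `GW(s, p)` -/

/-- Degree distributions `p = (p_k)_{k ≥ 2}` with unbounded support and finite mean. -/
structure DegreeDist where
  /-- the probabilities -/
  p : ℕ → ℝ
  nonneg : ∀ k, 0 ≤ p k
  lt_one : ∀ k, p k < 1
  zero : p 0 = 0
  one : p 1 = 0
  hasSum : HasSum p 1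
  partial_lt : ∀ n : ℕ, ∑ k ∈ Finset.Icc 2 n, p k < 1
  summable_mean : Summable fun k : ℕ => (k : ℝ) * p k

namespace DegreeDist

/-- The mean `a = ∑ k p_k`. -/
def a (D : DegreeDist) : ℝ := ∑' k : ℕ, (k : ℝ) * D.p k

/-- The size-biased probabilities `k p_k / a`. -/
def phat (D : DegreeDist) (k : ℕ) : ℝ := k * D.p k / D.a

theorem hasSum_mean (D : DegreeDist) : HasSum (fun k : ℕ => (k : ℝ) * D.p k) D.a :=
  D.summable_mean.hasSum

theorem a_pos (D : DegreeDist) : 0 < D.a := by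
  have h : (1 : ℝ) ≤ D.a := by
    refine hasSum_le (fun k => ?_) D.hasSum D.hasSum_mean
    rcases Nat.eq_zero_or_pos k with rfl | hk
    · simp [D.zero]
    · have : (1 : ℝ) ≤ k := by exact_mod_cast hk
      nlinarith [D.nonneg k]
  linarith

theorem phat_nonneg (D : DegreeDist) (k : ℕ) : 0 ≤ D.phat k :=
  div_nonneg (mul_nonneg (Nat.cast_nonneg k) (D.nonneg k)) D.a_pos.le

theorem hasSum_phat (D : DegreeDist) : HasSum D.phat 1 := by
  have h := D.hasSum_mean.div_const D.a
  rwa [div_self D.a_pos.ne'] at h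

/-- The probability law on `ℕ` with weights `f`. -/
def toPMF (f : ℕ → ℝ) (h0 : ∀ k, 0 ≤ f k) (h1 : HasSum f 1) : PMF ℕ :=
  ⟨fun k => ENNReal.ofReal (f k), by
    have h := ENNReal.ofReal_tsum_of_nonneg h0 h1.summable
    rw [h1.tsum_eq, ENNReal.ofReal_one] at h
    rw [h]
    exact ENNReal.summable.hasSum⟩

theorem hasSum_shift {f : ℕ → ℝ} (h0 : f 0 = 0) (h1 : HasSum f 1) :
    HasSum (fun m => f (m + 1)) 1 := by
  rw [hasSum_nat_add_iff' 1 |>.symm] at h1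
  simpa [h0] using h1

/-- Offspring law of an ordinary individual: `m` children with probability `p_{m+1}`. -/
def ordinaryLaw (D : DegreeDist) : PMF ℕ :=
  toPMF (fun m => D.p (m + 1)) (fun _ => D.nonneg _) (hasSum_shift D.zero D.hasSum)

/-- Offspring law of a distinguished individual: `m` children with probability
`(m + 1) p_{m+1} / a`. -/
def distinguishedLaw (D : DegreeDist) : PMF ℕ :=
  toPMF (fun m => D.phat (m + 1)) (fun _ => D.phat_nonneg _)
    (hasSum_shift (by simp [phat]) D.hasSum_phat)

/-- The size-biased law itself: `m` with probability `m p_m / a`. -/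
def sizeBiasedLaw (D : DegreeDist) : PMF ℕ :=
  toPMF D.phat D.phat_nonneg D.hasSum_phat

/-- `K_c = (1/4) ln (a / (a - 1))`. -/
def Kc (D : DegreeDist) : ℝ := 1 / 4 * Real.log (D.a / (D.a - 1))

/-- `b = ∑_{k ≥ 2} k p_k ln k` is finite (all terms are nonnegative). -/
def FiniteB (D : DegreeDist) : Prop := Summable fun k : ℕ => (k : ℝ) * D.p k * Real.log k

/-- `b_α = ∑_{k ≥ s+1} (k - s)^α k p_k / a` is finite (all terms are nonnegative). -/
def FiniteBα (D : DegreeDist) (s : ℕ) (α : ℝ) : Prop :=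
  Summable fun k : ℕ => if s + 1 ≤ k then ((k : ℝ) - s) ^ α * D.phat k else 0

end DegreeDist

/-- `(1/4) ln ((s^{1/α} + 1) / s^{1/α})`. -/
def KcHat (s : ℕ) (α : ℝ) : ℝ :=
  1 / 4 * Real.log (((s : ℝ) ^ (1 / α) + 1) / (s : ℝ) ^ (1 / α))

namespace GW

/-- Individuals carry labels in `List ℕ`: the root is `[]`, and the children of `u` are
`0 :: u, 1 :: u, …`. The first `s` children of a distinguished individual are distinguished and
all other individuals are ordinary; the root is distinguished, unless `s = 0`, when there are only
ordinary individuals. Hence the type of an individual can be read off from its label. -/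
def IsDistinguished (s : ℕ) (u : List ℕ) : Prop := 1 ≤ s ∧ ∀ i ∈ u, i < s

open Classical in
/-- Law of the number of children of the individual `u`, when `ρ` is the offspring law of a
distinguished root. -/
def offspringLaw (D : DegreeDist) (ρ : PMF ℕ) (s : ℕ) (u : List ℕ) : PMF ℕ :=
  if IsDistinguished s u then
    if u = [] then ρ else D.distinguishedLaw
  else D.ordinaryLaw

/-- The joint law of the numbers of children: they are independent over the labels. -/
def law (D : DegreeDist) (ρ : PMF ℕ) (s : ℕ) : Measure (List ℕ → ℕ) :=
  Measure.infinitePi fun u => (offspringLaw D ρ s u).toMeasure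

/-- The individual `u` is born, when `ω v` is the number of children of `v`. -/
def IsBorn (ω : List ℕ → ℕ) : List ℕ → Prop
  | [] => True
  | i :: u => i < ω u ∧ IsBorn ω u

/-- The vertices of the genealogic tree. -/
abbrev Vertex (ω : List ℕ → ℕ) : Type := {u : List ℕ // IsBorn ω u}

/-- The root of the genealogic tree. -/
def root (ω : List ℕ → ℕ) : Vertex ω := ⟨[], trivial⟩

/-- The genealogic tree: edges join each individual with its children. -/
def tree (ω : List ℕ → ℕ) : SimpleGraph (Vertex ω) where
  Adj u v := (∃ i, v.1 = i :: u.1) ∨ ∃ i, u.1 = i :: v.1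
  symm := ⟨fun _ _ h => h.symm⟩
  loopless := ⟨fun _ h => by
    rcases h with ⟨i, h⟩ | ⟨i, h⟩ <;> simpa using congrArg List.length h⟩

end GW

end

/-!
The proof compares the decay of correlations along a path with the growth of the tree.

**Decay.** For a fixed tree, write the Boltzmann factor of an inner edge as
`exp (K_xy σ_x σ_y + K) = 1 + w` with `0 ≤ w ≤ θ (1 + w)`, where `θ ≥ 1 - exp (-2 K)`, and expand
the product over the sets `A` of open edges. If no open path joins `z` to the sphere `S_n`, then
reversing the spins of a union of open clusters that contains `z` and misses `S_n` shows that `A`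
does not contribute to the magnetization at `z`. An open path to `x ∈ S_n` uses the last
`n - |z|` edges of the line of descent of `x`, which are all open with probability at most
`θ ^ (n - |z|)`. Hence `|M_{n,z}(ξ)| ≤ |S_n| θ ^ (n - |z|)` (`GW.abs_magnetization_le`), and
`θ ^ n |S_n| → 0` implies that the state is paramagnetic. There is much room in the thresholds:
with `m = a - 1` for `s ≤ 1` and `m = max (a - 1) (s ^ (1 / α))` for `s ≥ 2`, the assumption on `K`
gives `K ≤ 1 / (4 m)`, so one may take `θ = 1 / (2 m)`.

**Growth.** It remains to see that `∑ |S_n| (2 m)⁻ⁿ < ∞` almost surely. Put `R = 3 m / 2`. The mean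
offspring number of distinguished individuals may be infinite, so it is truncated at `M R ^ n` in
generation `n`. For the truncated tree, the mean number of ordinary individuals satisfies
`O_{n+1} ≤ (a - 1) O_n + s ^ n e_n`, where `e_n` is the truncated mean, and
`s ^ n e_n ≤ C R ^ n`: trivially for `s ≤ 1`, by the moment of order `α` for `s ≥ 2`. So the mean
grows at most like `R ^ n` (`GW.levelSum_isTame_le`). By Borel–Cantelli, under the logarithmic
moment for `s = 1` and the moment of order `α` for `s ≥ 2`, the truncation almost surely has no
effect for some random `M` (`GW.ae_exists_le_mul_pow`).
-/

noncomputable section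

open scoped ENNReal NNReal

/-! ### The random-cluster expansion -/

namespace Ising

open Classical in
/-- The configuration `σ` with the spins in `F` reversed. -/
def flip {Λ : Type*} (F : Set Λ) (σ : Λ → ℤˣ) : Λ → ℤˣ := fun x => if x ∈ F then -σ x else σ x

theorem flip_involutive {Λ : Type*} (F : Set Λ) : Function.Involutive (flip F) := by
  intro σ
  funext x
  by_cases h : x ∈ F <;> simp [flip, h]

theorem flip_apply_mem {Λ : Type*} {F : Set Λ} {x : Λ} (h : x ∈ F) (σ : Λ → ℤˣ) :
    flip F σ x = -σ x := by simp [flip, h]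

theorem flip_apply_notMem {Λ : Type*} {F : Set Λ} {x : Λ} (h : x ∉ F) (σ : Λ → ℤˣ) :
    flip F σ x = σ x := by simp [flip, h]

/-- When each `e ∈ E` is open with weight `w e` and closed with weight `1`, independently, the
probability that all of `P` is open is at most `θ ^ |P|`. -/
theorem sum_prod_superset_le {ι : Type*} [DecidableEq ι] (E P : Finset ι) (hP : P ⊆ E)
    (w : ι → ℝ) {θ : ℝ} (hw0 : ∀ e ∈ E, 0 ≤ w e) (hwθ : ∀ e ∈ E, w e ≤ θ * (1 + w e)) :
    ∑ A ∈ E.powerset with P ⊆ A, ∏ e ∈ A, w e ≤ θ ^ P.card * ∏ e ∈ E, (1 + w e) := by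
  have h1 : ∑ A ∈ E.powerset with P ⊆ A, ∏ e ∈ A, w e
      = ∏ e ∈ E, (w e + if e ∈ P then 0 else 1) := by
    rw [Finset.prod_add, Finset.sum_filter]
    refine Finset.sum_congr rfl fun A hA => ?_
    split_ifs with h
    · rw [Finset.prod_eq_one (s := E \ A), mul_one]
      intro e he
      rw [if_neg fun h' => (Finset.mem_sdiff.1 he).2 (h h')]
    · obtain ⟨e, heP, heA⟩ := Finset.not_subset.1 h
      have h0 : (if e ∈ P then (0 : ℝ) else 1) = 0 := if_pos heP
      rw [Finset.prod_eq_zero (Finset.mem_sdiff.2 ⟨hP heP, heA⟩) h0, mul_zero]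
  have h2 : θ ^ P.card * ∏ e ∈ E, (1 + w e)
      = ∏ e ∈ E, ((if e ∈ P then θ else 1) * (1 + w e)) := by
    rw [Finset.prod_mul_distrib, Finset.prod_ite_mem, Finset.inter_eq_right.2 hP,
      Finset.prod_const]
  rw [h1, h2]
  refine Finset.prod_le_prod (fun e he => ?_) fun e he => ?_
  · have := hw0 e he
    split_ifs <;> linarith
  · have := hwθ e he
    split_ifs <;> linarith

/-- A random-cluster bound. Expand `∏ (1 + w e)` over the sets `A` of open edges. If, for each `A`
that contains none of the sets `P x`, some set of spins containing the one at `z` can be reversed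
without changing `B` and the weights of the edges in `A`, then only those `A` that contain some `P x`
contribute to the magnetization at `z`, and `P x` is open with probability at most `θ ^ k`. -/
theorem abs_sum_spin_le {Λ ι κ : Type*} [Fintype Λ] [DecidableEq Λ] [DecidableEq ι]
    (E : Finset ι) (w : ι → (Λ → ℤˣ) → ℝ) (B : (Λ → ℤˣ) → ℝ) {θ : ℝ}
    (hw0 : ∀ e ∈ E, ∀ σ, 0 ≤ w e σ) (hwθ : ∀ e ∈ E, ∀ σ, w e σ ≤ θ * (1 + w e σ))
    (hB : ∀ σ, 0 ≤ B σ) (z : Λ) (X : Finset κ) (P : κ → Finset ι) {k : ℕ}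
    (hP : ∀ x ∈ X, P x ⊆ E) (hcard : ∀ x ∈ X, (P x).card = k)
    (hflip : ∀ A ⊆ E, (∀ x ∈ X, ¬ P x ⊆ A) → ∃ F : Set Λ, z ∈ F ∧
      ∀ σ, B (flip F σ) = B σ ∧ ∀ e ∈ A, w e (flip F σ) = w e σ) :
    |∑ σ : Λ → ℤˣ, ((σ z : ℤ) : ℝ) * ((∏ e ∈ E, (1 + w e σ)) * B σ)|
      ≤ X.card * θ ^ k * ∑ σ : Λ → ℤˣ, (∏ e ∈ E, (1 + w e σ)) * B σ := by
  have hterm : ∀ A ∈ E.powerset,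
      |∑ σ : Λ → ℤˣ, ((σ z : ℤ) : ℝ) * ((∏ e ∈ A, w e σ) * B σ)|
        ≤ ∑ x ∈ X, if P x ⊆ A then ∑ σ : Λ → ℤˣ, (∏ e ∈ A, w e σ) * B σ else 0 := by
    intro A hA
    rw [Finset.mem_powerset] at hA
    have hU : ∀ σ, 0 ≤ (∏ e ∈ A, w e σ) * B σ := fun σ =>
      mul_nonneg (Finset.prod_nonneg fun e he => hw0 e (hA he) σ) (hB σ)
    have hnn : ∀ x ∈ X,
        0 ≤ if P x ⊆ A then ∑ σ : Λ → ℤˣ, (∏ e ∈ A, w e σ) * B σ else 0 := by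
      intro x _
      split_ifs
      exacts [Finset.sum_nonneg fun σ _ => hU σ, le_rfl]
    by_cases h : ∃ x ∈ X, P x ⊆ A
    · obtain ⟨x, hx, hxA⟩ := h
      refine le_trans ?_ (Finset.single_le_sum hnn hx)
      rw [if_pos hxA]
      refine (Finset.abs_sum_le_sum_abs _ _).trans (Finset.sum_le_sum fun σ _ => ?_)
      rw [abs_mul, abs_of_nonneg (hU σ)]
      rcases Int.units_eq_one_or (σ z) with h | h <;> simp [h]
    · push Not at h
      obtain ⟨F, hz, hF⟩ := hflip A hA h
      -- The involution `flip F` changes the sign of each term.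
      have h0 : ∑ σ : Λ → ℤˣ, ((σ z : ℤ) : ℝ) * ((∏ e ∈ A, w e σ) * B σ)
          = -∑ σ : Λ → ℤˣ, ((σ z : ℤ) : ℝ) * ((∏ e ∈ A, w e σ) * B σ) := by
        conv_lhs => rw [← Equiv.sum_comp (flip_involutive F).toPerm]
        rw [← Finset.sum_neg_distrib]
        refine Finset.sum_congr rfl fun σ _ => ?_
        rw [Function.Involutive.coe_toPerm, (hF σ).1, Finset.prod_congr rfl (hF σ).2,
          flip_apply_mem hz]
        push_cast
        ring
      rw [show ∑ σ : Λ → ℤˣ, ((σ z : ℤ) : ℝ) * ((∏ e ∈ A, w e σ) * B σ) = 0 by linarith, abs_zero]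
      exact Finset.sum_nonneg hnn
  have hexp : ∀ σ : Λ → ℤˣ, ∏ e ∈ E, (1 + w e σ) = ∑ A ∈ E.powerset, ∏ e ∈ A, w e σ :=
    fun σ => Finset.prod_one_add E
  calc |∑ σ : Λ → ℤˣ, ((σ z : ℤ) : ℝ) * ((∏ e ∈ E, (1 + w e σ)) * B σ)|
      = |∑ A ∈ E.powerset, ∑ σ : Λ → ℤˣ, ((σ z : ℤ) : ℝ) * ((∏ e ∈ A, w e σ) * B σ)| := by
        rw [Finset.sum_comm]
        congr 1
        refine Finset.sum_congr rfl fun σ _ => ?_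
        rw [hexp, Finset.sum_mul, Finset.mul_sum]
    _ ≤ ∑ A ∈ E.powerset, ∑ x ∈ X,
          if P x ⊆ A then ∑ σ : Λ → ℤˣ, (∏ e ∈ A, w e σ) * B σ else 0 :=
        (Finset.abs_sum_le_sum_abs _ _).trans (Finset.sum_le_sum hterm)
    _ = ∑ x ∈ X, ∑ σ : Λ → ℤˣ, (∑ A ∈ E.powerset with P x ⊆ A, ∏ e ∈ A, w e σ) * B σ := by
        rw [Finset.sum_comm]
        refine Finset.sum_congr rfl fun x _ => ?_
        rw [← Finset.sum_filter, Finset.sum_comm]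
        exact Finset.sum_congr rfl fun σ _ => (Finset.sum_mul _ _ _).symm
    _ ≤ ∑ x ∈ X, ∑ σ : Λ → ℤˣ, θ ^ k * ((∏ e ∈ E, (1 + w e σ)) * B σ) := by
        refine Finset.sum_le_sum fun x hx => Finset.sum_le_sum fun σ _ => ?_
        rw [← mul_assoc]
        refine mul_le_mul_of_nonneg_right ?_ (hB σ)
        rw [← hcard x hx]
        exact sum_prod_superset_le E (P x) (hP x hx) _ (fun e he => hw0 e he σ)
          fun e he => hwθ e he σ
    _ = X.card * θ ^ k * ∑ σ : Λ → ℤˣ, (∏ e ∈ E, (1 + w e σ)) * B σ := by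
        rw [Finset.sum_const, ← Finset.mul_sum, nsmul_eq_mul, mul_assoc]

end Ising

/-! ### The Ising model on a genealogical tree -/

namespace GW

variable {ω : List ℕ → ℕ}

theorem isBorn_of_suffix {u v : List ℕ} (h : u <:+ v) (hv : IsBorn ω v) : IsBorn ω u := by
  induction v with
  | nil => rwa [List.suffix_nil.1 h]
  | cons i v ih =>
    rcases List.suffix_cons_iff.1 h with rfl | h
    exacts [hv, ih h hv.2]

/-- The parent of an individual; the root is its own parent. -/
def parent (u : Vertex ω) : Vertex ω := ⟨u.1.tail, isBorn_of_suffix (List.tail_suffix _) u.2⟩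

/-- The edge between an individual and its parent (a loop, hence no edge, at the root). -/
def parentEdge (u : Vertex ω) : Sym2 (Vertex ω) := s(u, parent u)

theorem parentEdge_injOn : Set.InjOn (parentEdge (ω := ω)) {u | u.1 ≠ []} := by
  intro u hu v hv h
  rcases Sym2.eq_iff.1 h with h | ⟨h1, h2⟩
  · exact h.1
  · have h1 := congrArg (fun x : Vertex ω => x.1.length) h1
    have h2 := congrArg (fun x : Vertex ω => x.1.length) h2
    have := List.length_pos_iff.2 hu
    have := List.length_pos_iff.2 hv
    simp only [parent, List.length_tail] at h1 h2
    omega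

theorem parentEdge_mem {u : Vertex ω} (hu : u.1 ≠ []) : parentEdge u ∈ (tree ω).edgeSet := by
  obtain ⟨_ | ⟨i, u⟩, h⟩ := u
  · exact absurd rfl hu
  · exact Or.inr ⟨i, rfl⟩

theorem exists_parentEdge {e : Sym2 (Vertex ω)} (he : e ∈ (tree ω).edgeSet) :
    ∃ u : Vertex ω, u.1 ≠ [] ∧ e = parentEdge u := by
  induction e with | _ x y
  obtain ⟨i, h⟩ | ⟨i, h⟩ : (∃ i, y.1 = i :: x.1) ∨ ∃ i, x.1 = i :: y.1 := he
  · refine ⟨y, by simp [h], ?_⟩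
    rw [Sym2.eq_swap, parentEdge, show parent y = x from Subtype.ext (by simp [parent, h])]
  · refine ⟨x, by simp [h], ?_⟩
    rw [parentEdge, show parent x = y from Subtype.ext (by simp [parent, h])]

theorem exists_walk_root (u : List ℕ) (hu : IsBorn ω u) :
    ∃ p : (tree ω).Walk (root ω) ⟨u, hu⟩, p.length = u.length := by
  induction u with
  | nil => exact ⟨SimpleGraph.Walk.nil, rfl⟩
  | cons i u ih =>
    obtain ⟨p, hp⟩ := ih hu.2
    have h : (tree ω).Adj ⟨u, hu.2⟩ ⟨i :: u, hu⟩ := Or.inl ⟨i, rfl⟩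
    exact ⟨p.concat h, by rw [SimpleGraph.Walk.length_concat, hp, List.length_cons]⟩

theorem length_le_of_walk {u v : Vertex ω} (p : (tree ω).Walk u v) :
    v.1.length ≤ u.1.length + p.length := by
  induction p with
  | nil => simp
  | cons h p ih =>
    rw [SimpleGraph.Walk.length_cons]
    rcases h with ⟨i, h⟩ | ⟨i, h⟩ <;> have := congrArg List.length h <;>
      rw [List.length_cons] at this <;> omega

theorem dist_root (u : Vertex ω) : (tree ω).dist (root ω) u = u.1.length := by
  obtain ⟨p, hp⟩ := exists_walk_root u.1 u.2
  refine le_antisymm (hp ▸ SimpleGraph.dist_le p) ?_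
  obtain ⟨q, hq⟩ := p.reachable.exists_walk_length_eq_dist
  have := length_le_of_walk q
  rw [← hq]
  simpa [root] using this

theorem mem_ball {n : ℕ} {u : Vertex ω} : u ∈ Ising.ball (tree ω) (root ω) n ↔ u.1.length ≤ n := by
  rw [Ising.ball, Set.mem_ofPred_eq, dist_root]

theorem mem_sphere {n : ℕ} {u : Vertex ω} :
    u ∈ Ising.sphere (tree ω) (root ω) n ↔ u.1.length = n := by
  rw [Ising.sphere, Set.mem_ofPred_eq, dist_root]

theorem finite_born (ω : List ℕ → ℕ) (n : ℕ) : {u | IsBorn ω u ∧ u.length = n}.Finite := by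
  induction n with
  | zero =>
    refine (Set.finite_singleton []).subset fun u hu => ?_
    exact List.length_eq_zero_iff.1 hu.2
  | succ n ih =>
    refine (ih.biUnion fun u _ =>
      ((Set.finite_Iio (ω u)).image fun i => i :: u)).subset fun v hv => ?_
    obtain ⟨hv, hn⟩ := hv
    cases v with
    | nil => simp at hn
    | cons i u =>
      simp only [Set.mem_iUnion]
      exact ⟨u, ⟨hv.2, by simpa using hn⟩, i, hv.1, rfl⟩

theorem finite_sphere (ω : List ℕ → ℕ) (n : ℕ) :
    (Ising.sphere (tree ω) (root ω) n).Finite := by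
  refine Set.Finite.of_finite_image ((finite_born ω n).subset ?_) Subtype.val_injective.injOn
  rintro _ ⟨u, hu, rfl⟩
  exact ⟨u.2, mem_sphere.1 hu⟩

theorem finite_ball (ω : List ℕ → ℕ) (n : ℕ) : (Ising.ball (tree ω) (root ω) n).Finite := by
  refine ((Set.finite_Iic n).biUnion fun k _ => finite_sphere ω k).subset fun u hu => ?_
  simp only [Set.mem_iUnion]
  exact ⟨_, mem_ball.1 hu, mem_sphere.2 rfl⟩

theorem parent_mem_ball {n : ℕ} {u : Vertex ω} (hu : u ∈ Ising.ball (tree ω) (root ω) n) :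
    parent u ∈ Ising.ball (tree ω) (root ω) n := by
  rw [mem_ball] at *
  simp only [parent, List.length_tail]
  omega

theorem parentEdge_mem_innerEdges {n : ℕ} {u : Vertex ω} (hu : u.1 ≠ []) (hn : u.1.length ≤ n) :
    parentEdge u ∈ Ising.innerEdges (tree ω) (root ω) n := by
  refine ⟨parentEdge_mem hu, fun x hx => ?_⟩
  rcases Sym2.mem_iff.1 hx with rfl | rfl
  exacts [mem_ball.2 hn, parent_mem_ball (mem_ball.2 hn)]

theorem finite_innerEdges (ω : List ℕ → ℕ) (n : ℕ) :
    (Ising.innerEdges (tree ω) (root ω) n).Finite := by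
  refine ((finite_ball ω n).image parentEdge).subset fun e he => ?_
  obtain ⟨u, -, rfl⟩ := exists_parentEdge he.1
  exact ⟨u, he.2 u (Sym2.mem_mk_left _ _), rfl⟩

/-- The `n - l` last edges on the line of descent from the root to `x`. For `x` in generation `n`
these are the edges between its ancestor in generation `l` and `x`. -/
def lineage (l n : ℕ) (x : Vertex ω) : Finset (Sym2 (Vertex ω)) :=
  (Finset.range (n - l)).image fun j =>
    parentEdge ⟨x.1.drop j, isBorn_of_suffix (List.drop_suffix _ _) x.2⟩

theorem card_lineage {l n : ℕ} {x : Vertex ω} (hx : x.1.length = n) :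
    (lineage l n x).card = n - l := by
  unfold lineage
  rw [Finset.card_image_of_injOn, Finset.card_range]
  intro i hi j hj h
  simp only [Finset.coe_range, Set.mem_Iio] at hi hj
  have h' := parentEdge_injOn (fun h => by
    have := congrArg List.length h; simp at this; omega) (fun h => by
    have := congrArg List.length h; simp at this; omega) h
  have := congrArg (fun u : Vertex ω => u.1.length) h'
  simp only [List.length_drop] at this
  omega

theorem lineage_subset {l n : ℕ} {x : Vertex ω} (hx : x.1.length = n) {e : Sym2 (Vertex ω)}
    (he : e ∈ lineage l n x) : e ∈ Ising.innerEdges (tree ω) (root ω) n := by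
  obtain ⟨j, hj, rfl⟩ := Finset.mem_image.1 he
  rw [Finset.mem_range] at hj
  refine parentEdge_mem_innerEdges (fun h => ?_) ?_
  · have := congrArg List.length h
    simp at this
    omega
  · simp [hx]

/-- The individuals that the edges in `A` leave attached to their ancestor in generation `l`,
together with the individuals up to generation `l`. -/
def attached (l : ℕ) (A : Finset (Sym2 (Vertex ω))) : Set (Vertex ω) :=
  {u | ∀ v : Vertex ω, v.1 <:+ u.1 → l < v.1.length → parentEdge v ∈ A}

/-- No edge of `A` joins `attached l A` to its complement. -/
theorem parent_mem_attached_iff {l : ℕ} {A : Finset (Sym2 (Vertex ω))} {u : Vertex ω}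
    (hA : parentEdge u ∈ A) : parent u ∈ attached l A ↔ u ∈ attached l A := by
  refine ⟨fun h v hv hl => ?_, fun h v hv => h v (hv.trans (List.tail_suffix _))⟩
  by_cases huv : v = u
  · rwa [huv]
  · refine h v ?_ hl
    obtain ⟨_ | ⟨i, u⟩, hu⟩ := u
    · exact hv
    · rcases List.suffix_cons_iff.1 hv with h' | h'
      exacts [absurd (Subtype.ext h') huv, h']

theorem notMem_attached {l n : ℕ} {A : Finset (Sym2 (Vertex ω))} {x : Vertex ω}
    (hx : x.1.length = n) (h : ¬ lineage l n x ⊆ A) : x ∉ attached l A := by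
  intro hxA
  refine h fun e he => ?_
  obtain ⟨j, hj, rfl⟩ := Finset.mem_image.1 he
  rw [Finset.mem_range] at hj
  refine hxA _ (List.drop_suffix _ _) ?_
  simp only [List.length_drop]
  omega

theorem edgeSpin_mk {V : Type*} (τ : V → ℤˣ) (x y : V) :
    Ising.edgeSpin τ s(x, y) = ((τ x : ℤ) : ℝ) * ((τ y : ℤ) : ℝ) := rfl

theorem abs_edgeSpin {V : Type*} (τ : V → ℤˣ) (e : Sym2 V) : |Ising.edgeSpin τ e| = 1 := by
  induction e with | _ x y
  rw [edgeSpin_mk]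
  rcases Int.units_eq_one_or (τ x) with h | h <;> rcases Int.units_eq_one_or (τ y) with h' | h' <;>
    simp [h, h']

/-- Given the spins, an edge is open in the random-cluster expansion with probability at most
`1 - exp (-2 K)`. A path from `z` to a vertex of generation `n` uses all the edges on the line of
descent of that vertex below the generation of `z`, so a union bound over generation `n` gives
the estimate. -/
theorem abs_magnetization_le (ω : List ℕ → ℕ) (J : Sym2 (Vertex ω) → ℝ)
    (hJ : BddAbove (Set.range fun e : (tree ω).edgeSet => |J e|)) {β : ℝ} (hβ : 0 < β) {θ : ℝ}
    (hθ : 1 - θ ≤ Real.exp (-(2 * Ising.couplingBound (tree ω) J β)))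
    (z : Vertex ω) (ξ : Vertex ω → ℤˣ) {n : ℕ} (hn : z.1.length ≤ n) :
    |Ising.magnetization (tree ω) (root ω) J β n ξ z| ≤
      (finite_sphere ω n).toFinset.card * θ ^ (n - z.1.length) := by
  classical
  set G := tree ω
  set o := root ω
  set K := Ising.couplingBound G J β
  have : Fintype (Ising.ball G o n) := (finite_ball ω n).fintype
  set E := (finite_innerEdges ω n).toFinset
  set w : Sym2 (Vertex ω) → (Ising.ball G o n → ℤˣ) → ℝ := fun e σ =>
    Real.exp (β * J e * Ising.edgeSpin (Ising.glue G o n σ ξ) e + K) - 1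
  set B : (Ising.ball G o n → ℤˣ) → ℝ := fun σ =>
    Real.exp (∑ᶠ e ∈ Ising.boundaryEdges G o n, β * J e * Ising.edgeSpin (Ising.glue G o n σ ξ) e)
  have hz : z ∈ Ising.ball G o n := mem_ball.2 hn
  have hweight : ∀ σ, Ising.weight G o J β n ξ σ = (∏ e ∈ E, (1 + w e σ)) * B σ := by
    intro σ
    simp only [w, B, add_sub_cancel]
    rw [Ising.weight, Real.exp_add, finsum_mem_eq_finite_toFinset_sum _ (finite_innerEdges ω n),
      Real.exp_sum]
  have hx : ∀ e ∈ E, ∀ σ, |β * J e * Ising.edgeSpin (Ising.glue G o n σ ξ) e| ≤ K := by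
    intro e he σ
    have he : e ∈ G.edgeSet := ((Set.Finite.mem_toFinset _).1 he).1
    rw [abs_mul, abs_edgeSpin, mul_one, abs_mul, abs_of_pos hβ]
    exact mul_le_mul_of_nonneg_left (le_ciSup hJ ⟨e, he⟩) hβ.le
  have key := Ising.abs_sum_spin_le (θ := θ) (k := n - z.1.length) E w B
    (fun e he σ => by
      have := neg_le_of_abs_le (hx e he σ)
      have := Real.one_le_exp (show 0 ≤ β * J e * Ising.edgeSpin (Ising.glue G o n σ ξ) e + K by
        linarith)
      simp only [w]
      linarith)
    (fun e he σ => by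
      have := le_of_abs_le (hx e he σ)
      have h1 : Real.exp (-(2 * K)) ≤
          Real.exp (-(β * J e * Ising.edgeSpin (Ising.glue G o n σ ξ) e + K)) :=
        Real.exp_le_exp.2 (by linarith)
      simp only [w]
      set y := β * J e * Ising.edgeSpin (Ising.glue G o n σ ξ) e + K
      have h2 : Real.exp (-y) * Real.exp y = 1 := by rw [← Real.exp_add]; simp
      have h3 := Real.exp_pos y
      nlinarith)
    (fun σ => (Real.exp_pos _).le) ⟨z, hz⟩ (finite_sphere ω n).toFinset (lineage z.1.length n)
    (fun x hx e he => (Set.Finite.mem_toFinset _).2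
      (lineage_subset (mem_sphere.1 ((Set.Finite.mem_toFinset _).1 hx)) he))
    (fun x hx => card_lineage (mem_sphere.1 ((Set.Finite.mem_toFinset _).1 hx)))
    (by
      intro A hA hAX
      refine ⟨{x | x.1 ∈ attached z.1.length A}, fun v hv hl => ?_, fun σ => ⟨?_, fun e he => ?_⟩⟩
      · exact absurd hv.length_le (not_le.2 hl)
      -- The boundary edges see only spins of generation `n`, and none of these is reversed.
      · simp only [B]
        congr 1
        refine finsum_mem_congr rfl fun e he => ?_
        obtain ⟨-, x, hx, y, hy, rfl⟩ := he
        have hyn : y ∉ Ising.ball G o n := by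
          rw [mem_ball, mem_sphere.1 hy]
          omega
        have hxn : x ∈ Ising.ball G o n := by
          rw [mem_ball, mem_sphere.1 hx]
        rw [edgeSpin_mk, edgeSpin_mk]
        simp only [Ising.glue, dif_pos hxn, dif_neg hyn]
        rw [Ising.flip_apply_notMem]
        exact notMem_attached (mem_sphere.1 hx) (hAX x ((Set.Finite.mem_toFinset _).2 hx))
      -- An edge of `A` has both or none of its spins reversed.
      · have hei := (Set.Finite.mem_toFinset _).1 (hA he)
        obtain ⟨u, -, rfl⟩ := exists_parentEdge hei.1
        have hu : u ∈ Ising.ball G o n := hei.2 u (Sym2.mem_mk_left _ _)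
        have hpu : parent u ∈ Ising.ball G o n := parent_mem_ball hu
        simp only [w]
        congr 4
        rw [parentEdge, edgeSpin_mk, edgeSpin_mk]
        simp only [Ising.glue, dif_pos hu, dif_pos hpu]
        have hiff := parent_mem_attached_iff (l := z.1.length) he
        by_cases h : u ∈ attached z.1.length A
        · rw [Ising.flip_apply_mem (by exact h), Ising.flip_apply_mem (by exact hiff.2 h)]
          push_cast
          ring
        · rw [Ising.flip_apply_notMem (by exact h),
            Ising.flip_apply_notMem (by exact fun h' => h (hiff.1 h'))])
  have hZ : Ising.partitionFunction G o J β n ξ = ∑ σ, (∏ e ∈ E, (1 + w e σ)) * B σ := by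
    rw [Ising.partitionFunction, finsum_eq_sum_of_fintype]
    exact Finset.sum_congr rfl fun σ _ => hweight σ
  have hZpos : 0 < Ising.partitionFunction G o J β n ξ := by
    rw [Ising.partitionFunction, finsum_eq_sum_of_fintype]
    exact Finset.sum_pos (fun σ _ => Real.exp_pos _) Finset.univ_nonempty
  have hM : Ising.magnetization G o J β n ξ z =
      (∑ σ : Ising.ball G o n → ℤˣ, ((σ ⟨z, hz⟩ : ℤ) : ℝ) * ((∏ e ∈ E, (1 + w e σ)) * B σ)) /
        Ising.partitionFunction G o J β n ξ := by
    rw [Ising.magnetization, finsum_eq_sum_of_fintype, Finset.sum_div]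
    refine Finset.sum_congr rfl fun σ _ => ?_
    rw [Ising.gibbs, hweight, ← mul_div_assoc]
    simp only [Ising.glue, dif_pos hz]
  rw [hM, abs_div, abs_of_pos hZpos, div_le_iff₀ hZpos]
  rw [← hZ] at key
  exact key

theorem isParamagnetic_of_tendsto (ω : List ℕ → ℕ) (J : Sym2 (Vertex ω) → ℝ)
    (hJ : BddAbove (Set.range fun e : (tree ω).edgeSet => |J e|)) {β : ℝ} (hβ : 0 < β) {θ : ℝ}
    (hθ0 : 0 < θ) (hθ : 2 * Ising.couplingBound (tree ω) J β ≤ θ)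
    (h : Tendsto (fun n => θ ^ n * ((finite_sphere ω n).toFinset.card : ℝ)) atTop (𝓝 0)) :
    Ising.IsParamagnetic (tree ω) (root ω) J β := by
  intro z ξ
  have h' := h.const_mul (θ ^ z.1.length)⁻¹
  rw [mul_zero] at h'
  refine squeeze_zero_norm' ?_ h'
  filter_upwards [eventually_ge_atTop z.1.length] with n hn
  rw [Real.norm_eq_abs]
  refine (abs_magnetization_le ω J hJ hβ (θ := θ) ?_ z ξ hn).trans (le_of_eq ?_)
  · have := Real.add_one_le_exp (-(2 * Ising.couplingBound (tree ω) J β))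
    linarith
  · rw [pow_sub₀ _ hθ0.ne' hn]
    ring

end GW

/-! ### Truncated means and tails -/

/-- The mean of `x` restricted to `x ≤ c`, where `x` has law `q`. -/
def truncatedMean (q : PMF ℕ) (c : ℝ) : ℝ≥0∞ :=
  ∑' x : ℕ, if (x : ℝ) ≤ c then (x : ℝ≥0∞) * q x else 0

/-- The tail-sum formula for the mean, restricted to the event `p`. -/
theorem tsum_toMeasure_lt_and (q : PMF ℕ) (p : ℕ → Prop) [DecidablePred p] :
    ∑' i : ℕ, q.toMeasure {x | i < x ∧ p x} = ∑' x : ℕ, if p x then (x : ℝ≥0∞) * q x else 0 := by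
  have h : ∀ i : ℕ, q.toMeasure {x | i < x ∧ p x} = ∑' x, if i < x ∧ p x then q x else 0 := by
    intro i
    rw [PMF.toMeasure_apply _ .of_discrete]
    simp [Set.indicator_apply]
  simp_rw [h]
  rw [ENNReal.tsum_comm]
  refine tsum_congr fun x => ?_
  by_cases hx : p x
  · simp only [hx, and_true, if_true]
    rw [tsum_eq_sum (s := Finset.range x) fun i hi => if_neg fun h => hi (Finset.mem_range.2 h),
      Finset.sum_congr rfl fun i hi => if_pos (Finset.mem_range.1 hi)]
    simp
  · simp [hx]

theorem truncatedMean_le (q : PMF ℕ) (c : ℝ) : truncatedMean q c ≤ ENNReal.ofReal c := by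
  calc truncatedMean q c ≤ ∑' x, ENNReal.ofReal c * q x := by
        refine ENNReal.tsum_le_tsum fun x => ?_
        split_ifs with h
        · gcongr
          rw [← ENNReal.ofReal_natCast]
          exact ENNReal.ofReal_le_ofReal h
        · exact zero_le
    _ = ENNReal.ofReal c := by rw [ENNReal.tsum_mul_left, q.tsum_coe, mul_one]

/-- Borel–Cantelli input when each generation has at most one distinguished individual. -/
theorem tsum_tail_ne_top_of_log {q : PMF ℕ} {R : ℝ} (hR : 1 < R)
    (hq : ∑' x : ℕ, ENNReal.ofReal (Real.log x) * q x ≠ ∞) :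
    ∑' n : ℕ, q.toMeasure {x : ℕ | R ^ n < x} ≠ ∞ := by
  have hlog : 0 < Real.log R := Real.log_pos hR
  have h : ∀ n : ℕ, q.toMeasure {x : ℕ | R ^ n < x} = ∑' x : ℕ, if R ^ n < x then q x else 0 := by
    intro n
    rw [PMF.toMeasure_apply _ .of_discrete]
    simp [Set.indicator_apply]
  simp_rw [h]
  rw [ENNReal.tsum_comm]
  refine ne_top_of_le_ne_top (b := ∑' x : ℕ, (ENNReal.ofReal (Real.log R)⁻¹ *
    (ENNReal.ofReal (Real.log x) * q x) + q x)) ?_ (ENNReal.tsum_le_tsum fun x => ?_)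
  · rw [ENNReal.tsum_add, ENNReal.tsum_mul_left, q.tsum_coe]
    exact ENNReal.add_ne_top.2 ⟨ENNReal.mul_ne_top ENNReal.ofReal_ne_top hq, ENNReal.one_ne_top⟩
  -- For fixed `x`, the terms `n ≥ log x / log R` vanish.
  · set N := ⌈Real.log x / Real.log R⌉₊
    have hx0 : 0 ≤ Real.log x := Real.log_natCast_nonneg x
    have hN : ∀ n ∉ Finset.range N, (if R ^ n < x then q x else 0) = 0 := by
      refine fun n hn => if_neg fun hx => hn ?_
      rw [Finset.mem_range, Nat.lt_ceil, lt_div_iff₀ hlog, ← Real.log_pow]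
      exact Real.log_lt_log (by positivity) hx
    rw [tsum_eq_sum hN]
    have hN' : (N : ℝ≥0∞) ≤ ENNReal.ofReal (Real.log R)⁻¹ * ENNReal.ofReal (Real.log x) + 1 := by
      rw [← ENNReal.ofReal_mul (by positivity), ← ENNReal.ofReal_one,
        ← ENNReal.ofReal_add (by positivity) one_pos.le, ← ENNReal.ofReal_natCast]
      refine ENNReal.ofReal_le_ofReal ?_
      have := (Nat.ceil_lt_add_one (show 0 ≤ Real.log x / Real.log R by positivity)).le
      exact this.trans_eq (by rw [div_eq_inv_mul])
    calc ∑ n ∈ Finset.range N, (if R ^ n < x then q x else 0)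
        ≤ ∑ n ∈ Finset.range N, q x := Finset.sum_le_sum fun n _ => by
          split_ifs
          exacts [le_rfl, zero_le]
      _ = N * q x := by simp
      _ ≤ (ENNReal.ofReal (Real.log R)⁻¹ * ENNReal.ofReal (Real.log x) + 1) * q x := by gcongr
      _ = _ := by ring

/-- Borel–Cantelli input when generation `n` has at most `s ^ n` distinguished individuals. -/
theorem tsum_tail_ne_top_of_rpow {q : PMF ℕ} {R α : ℝ} {s : ℕ} (hR : 0 < R) (hα : 0 < α)
    (hs : s < R ^ α) (hq : ∑' x : ℕ, ENNReal.ofReal ((x : ℝ) ^ α) * q x ≠ ∞) :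
    ∑' n : ℕ, (s : ℝ≥0∞) ^ n * q.toMeasure {x : ℕ | R ^ n < x} ≠ ∞ := by
  have hRα : 0 < R ^ α := by positivity
  set r := s / R ^ α
  have hr0 : 0 ≤ r := by positivity
  have hr1 : r < 1 := (div_lt_one hRα).2 hs
  have h : ∀ n : ℕ, (s : ℝ≥0∞) ^ n * q.toMeasure {x : ℕ | R ^ n < x} ≤
      ENNReal.ofReal r ^ n * ∑' x : ℕ, ENNReal.ofReal ((x : ℝ) ^ α) * q x := by
    intro n
    rw [PMF.toMeasure_apply _ .of_discrete, ← ENNReal.tsum_mul_left,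
      ← ENNReal.tsum_mul_left]
    refine ENNReal.tsum_le_tsum fun x => ?_
    rw [Set.indicator_apply]
    split_ifs with hx
    · rw [← mul_assoc]
      gcongr
      rw [← ENNReal.ofReal_natCast, ← ENNReal.ofReal_pow (by positivity),
        ← ENNReal.ofReal_pow hr0, ← ENNReal.ofReal_mul (by positivity)]
      refine ENNReal.ofReal_le_ofReal ?_
      have h1 : (R ^ α) ^ n ≤ (x : ℝ) ^ α := by
        rw [Real.rpow_pow_comm hR.le]
        exact Real.rpow_le_rpow (by positivity) (le_of_lt hx) hα.le
      have h2 : (s : ℝ) ^ n = r ^ n * (R ^ α) ^ n := by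
        rw [← mul_pow, div_mul_cancel₀ _ hRα.ne']
      rw [h2]
      gcongr
    · simp
  refine ne_top_of_le_ne_top ?_ (ENNReal.tsum_le_tsum h)
  rw [ENNReal.tsum_mul_right, ENNReal.tsum_geometric]
  refine ENNReal.mul_ne_top (ENNReal.inv_ne_top.2 ?_) hq
  rw [← ENNReal.ofReal_one, ← ENNReal.ofReal_sub _ hr0]
  simpa using hr1

/-- On `x ≤ M R ^ n` one has `x ≤ x ^ α (M R ^ n) ^ (1 - α)`, and `s R ^ (1 - α) ≤ R`. -/
theorem truncatedMean_le_of_rpow {q : PMF ℕ} {R α : ℝ} {s : ℕ} (hR : 0 < R)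
    (hα1 : α < 1) (hs : s < R ^ α) (M n : ℕ) :
    (s : ℝ≥0∞) ^ n * truncatedMean q (M * R ^ n) ≤
      ENNReal.ofReal ((M : ℝ) ^ (1 - α)) * (∑' x : ℕ, ENNReal.ofReal ((x : ℝ) ^ α) * q x) *
        ENNReal.ofReal R ^ n := by
  rw [truncatedMean, ← ENNReal.tsum_mul_left, ← ENNReal.tsum_mul_left, ← ENNReal.tsum_mul_right]
  refine ENNReal.tsum_le_tsum fun x => ?_
  split_ifs with hx
  · suffices h : (s : ℝ≥0∞) ^ n * x ≤ ENNReal.ofReal ((M : ℝ) ^ (1 - α)) *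
        ENNReal.ofReal ((x : ℝ) ^ α) * ENNReal.ofReal R ^ n by
      calc (s : ℝ≥0∞) ^ n * (x * q x) = ((s : ℝ≥0∞) ^ n * x) * q x := by ring
        _ ≤ _ * q x := mul_le_mul_left h _
        _ = _ := by ring
    rw [← ENNReal.ofReal_natCast, ← ENNReal.ofReal_natCast, ← ENNReal.ofReal_pow (by positivity),
      ← ENNReal.ofReal_pow hR.le, ← ENNReal.ofReal_mul (by positivity),
      ← ENNReal.ofReal_mul (by positivity), ← ENNReal.ofReal_mul (by positivity)]
    refine ENNReal.ofReal_le_ofReal ?_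
    have h1 : (x : ℝ) = (x : ℝ) ^ α * (x : ℝ) ^ (1 - α) := by
      rw [← Real.rpow_add' (by positivity) (by norm_num)]
      simp
    have h2 : (x : ℝ) ^ (1 - α) ≤ (M : ℝ) ^ (1 - α) * (R ^ n) ^ (1 - α) := by
      rw [← Real.mul_rpow (by positivity) (by positivity)]
      exact Real.rpow_le_rpow (by positivity) hx (by linarith)
    have h3 : (s : ℝ) ^ n * (R ^ n) ^ (1 - α) ≤ R ^ n := by
      calc (s : ℝ) ^ n * (R ^ n) ^ (1 - α) ≤ (R ^ α) ^ n * (R ^ n) ^ (1 - α) := by gcongr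
        _ = (R ^ n) ^ α * (R ^ n) ^ (1 - α) := by
          rw [Real.rpow_pow_comm hR.le]
        _ = R ^ n := by
          rw [← Real.rpow_add (by positivity)]
          simp
    calc (s : ℝ) ^ n * x = (s : ℝ) ^ n * ((x : ℝ) ^ α * (x : ℝ) ^ (1 - α)) := by rw [← h1]
      _ ≤ (s : ℝ) ^ n * ((x : ℝ) ^ α * ((M : ℝ) ^ (1 - α) * (R ^ n) ^ (1 - α))) := by gcongr
      _ = (M : ℝ) ^ (1 - α) * (x : ℝ) ^ α * ((s : ℝ) ^ n * (R ^ n) ^ (1 - α)) := by ring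
      _ ≤ (M : ℝ) ^ (1 - α) * (x : ℝ) ^ α * R ^ n := by gcongr
  · simp

/-! ### Moments of the offspring laws -/

namespace DegreeDist

theorem two_le_a (D : DegreeDist) : 2 ≤ D.a := by
  refine hasSum_le (fun k => ?_) (by simpa using D.hasSum.mul_left 2) D.hasSum_mean
  rcases k with _ | _ | k
  · simp [D.zero]
  · simp [D.one]
  · have := D.nonneg (k + 2)
    push_cast
    nlinarith [(Nat.cast_nonneg k : (0 : ℝ) ≤ k)]

theorem toPMF_apply (f : ℕ → ℝ) (h0 : ∀ k, 0 ≤ f k) (h1 : HasSum f 1) (k : ℕ) :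
    toPMF f h0 h1 k = ENNReal.ofReal (f k) := rfl

theorem tsum_mul_ordinaryLaw (D : DegreeDist) :
    ∑' x : ℕ, (x : ℝ≥0∞) * D.ordinaryLaw x = ENNReal.ofReal (D.a - 1) := by
  have h : HasSum (fun m : ℕ => (m : ℝ) * D.p (m + 1)) (D.a - 1) := by
    have h1 : HasSum (fun m : ℕ => ((m + 1 : ℕ) : ℝ) * D.p (m + 1)) D.a := by
      simpa using (hasSum_nat_add_iff' (f := fun k : ℕ => (k : ℝ) * D.p k) 1).2 D.hasSum_mean
    refine (h1.sub (hasSum_shift D.zero D.hasSum)).congr_fun fun m => ?_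
    push_cast
    ring
  rw [← h.tsum_eq, ENNReal.ofReal_tsum_of_nonneg
    (fun m => mul_nonneg (Nat.cast_nonneg m) (D.nonneg _)) h.summable]
  refine tsum_congr fun x => ?_
  rw [ordinaryLaw, toPMF_apply, ENNReal.ofReal_mul (Nat.cast_nonneg x), ENNReal.ofReal_natCast]

theorem FiniteB.tsum_log_ne_top {D : DegreeDist} (h : D.FiniteB) :
    ∑' x : ℕ, ENNReal.ofReal (Real.log x) * D.distinguishedLaw x ≠ ∞ := by
  have h1 : Summable fun x : ℕ => (((x + 1 : ℕ) : ℝ) * D.p (x + 1) * Real.log (x + 1 : ℕ)) / D.a :=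
    ((summable_nat_add_iff 1).2 h).div_const _
  refine ne_top_of_le_ne_top h1.tsum_ofReal_ne_top (ENNReal.tsum_le_tsum fun x => ?_)
  rw [distinguishedLaw, toPMF_apply, ← ENNReal.ofReal_mul (Real.log_natCast_nonneg x)]
  refine ENNReal.ofReal_le_ofReal ?_
  have h2 : Real.log x ≤ Real.log (x + 1 : ℕ) := by
    rcases Nat.eq_zero_or_pos x with rfl | hx
    · simp
    · exact Real.log_le_log (by exact_mod_cast hx) (by push_cast; linarith)
  calc Real.log x * D.phat (x + 1) ≤ Real.log (x + 1 : ℕ) * D.phat (x + 1) :=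
        mul_le_mul_of_nonneg_right h2 (D.phat_nonneg _)
    _ = _ := by
      rw [phat]
      ring

/-- `FiniteBα` bounds `(k - s) ^ α` for `k = x + 1 ≥ s + 1`, where `x ≤ (s + 1) (k - s)`. -/
theorem FiniteBα.tsum_rpow_ne_top {D : DegreeDist} {s : ℕ} {α : ℝ} (hα : 0 < α)
    (h : D.FiniteBα s α) :
    ∑' x : ℕ, ENNReal.ofReal ((x : ℝ) ^ α) * D.distinguishedLaw x ≠ ∞ := by
  have h1 : Summable fun k : ℕ => ((s : ℝ) + 1) ^ α *
      (if s + 1 ≤ k then ((k : ℝ) - s) ^ α * D.phat k else 0) + (s : ℝ) ^ α * D.phat k :=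
    (Summable.mul_left _ h).add (D.hasSum_phat.summable.mul_left _)
  refine ne_top_of_le_ne_top ((summable_nat_add_iff 1).2 h1).tsum_ofReal_ne_top
    (ENNReal.tsum_le_tsum fun x => ?_)
  rw [distinguishedLaw, toPMF_apply, ← ENNReal.ofReal_mul (by positivity)]
  refine ENNReal.ofReal_le_ofReal ?_
  have hp := D.phat_nonneg (x + 1)
  split_ifs with hx
  · have hx' : (s : ℝ) ≤ x := by exact_mod_cast Nat.le_of_succ_le_succ hx
    have h2 : (x : ℝ) ^ α ≤ ((s : ℝ) + 1) ^ α * (((x + 1 : ℕ) : ℝ) - s) ^ α := by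
      push_cast
      rw [← Real.mul_rpow (by positivity) (by linarith)]
      refine Real.rpow_le_rpow (by positivity) ?_ hα.le
      nlinarith [(Nat.cast_nonneg s : (0 : ℝ) ≤ s)]
    have h3 : 0 ≤ (s : ℝ) ^ α * D.phat (x + 1) := by positivity
    nlinarith [mul_le_mul_of_nonneg_right h2 hp]
  · have hx' : (x : ℝ) ≤ s := by exact_mod_cast (show x ≤ s by omega)
    rw [mul_zero, zero_add]
    exact mul_le_mul_of_nonneg_right (Real.rpow_le_rpow (by positivity) hx' hα.le) hp

end DegreeDist

/-! ### Sums over generations -/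

namespace GW

/-- The sum of `g` over the labels of generation `n`. -/
def levelSum (g : List ℕ → ℝ≥0∞) (n : ℕ) : ℝ≥0∞ := ∑' v : List ℕ, if v.length = n then g v else 0

theorem levelSum_zero (g : List ℕ → ℝ≥0∞) : levelSum g 0 = g [] := by
  rw [levelSum, tsum_eq_single []]
  · simp
  · intro v hv
    simp [hv]

theorem levelSum_succ (g : List ℕ → ℝ≥0∞) (n : ℕ) :
    levelSum g (n + 1) = levelSum (fun u => ∑' i, g (i :: u)) n := by
  have hinj : Function.Injective fun p : List ℕ × ℕ => p.2 :: p.1 := by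
    rintro ⟨u, i⟩ ⟨v, j⟩ h
    simp only [List.cons.injEq] at h
    rw [h.1, h.2]
  have hsupp : Function.support (fun v : List ℕ => if v.length = n + 1 then g v else 0) ⊆
      Set.range fun p : List ℕ × ℕ => p.2 :: p.1 := by
    intro v hv
    cases v with
    | nil => simp at hv
    | cons i u => exact ⟨(u, i), rfl⟩
  rw [levelSum, ← hinj.tsum_eq hsupp, ENNReal.tsum_prod', levelSum]
  refine tsum_congr fun u => ?_
  by_cases h : u.length = n <;> simp [h]

theorem levelSum_mono {g h : List ℕ → ℝ≥0∞} {n : ℕ} (H : ∀ v, v.length = n → g v ≤ h v) :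
    levelSum g n ≤ levelSum h n := by
  refine ENNReal.tsum_le_tsum fun v => ?_
  split_ifs with hv
  exacts [H v hv, le_rfl]

theorem levelSum_add (g h : List ℕ → ℝ≥0∞) (n : ℕ) :
    levelSum (fun v => g v + h v) n = levelSum g n + levelSum h n := by
  rw [levelSum, levelSum, levelSum, ← ENNReal.tsum_add]
  refine tsum_congr fun v => ?_
  split_ifs <;> simp

theorem levelSum_mul_const (g : List ℕ → ℝ≥0∞) (c : ℝ≥0∞) (n : ℕ) :
    levelSum (fun v => g v * c) n = levelSum g n * c := by
  rw [levelSum, levelSum, ← ENNReal.tsum_mul_right]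
  refine tsum_congr fun v => ?_
  split_ifs <;> simp

theorem tsum_levelSum (g : List ℕ → ℝ≥0∞) : ∑' n, levelSum g n = ∑' v, g v := by
  simp_rw [levelSum]
  rw [ENNReal.tsum_comm]
  exact tsum_congr fun v => by simp

theorem isDistinguished_cons {s i : ℕ} {u : List ℕ} :
    IsDistinguished s (i :: u) ↔ i < s ∧ IsDistinguished s u := by
  simp only [IsDistinguished, List.mem_cons, forall_eq_or_imp]
  tauto

open Classical in
theorem levelSum_isDistinguished_le (s n : ℕ) :
    levelSum (fun u => if IsDistinguished s u then 1 else 0) n ≤ (s : ℝ≥0∞) ^ n := by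
  induction n with
  | zero =>
    rw [levelSum_zero, pow_zero]
    split_ifs <;> simp
  | succ n ih =>
    rw [levelSum_succ, pow_succ]
    refine le_trans (le_of_eq ?_) (mul_le_mul_left ih (s : ℝ≥0∞))
    rw [← levelSum_mul_const]
    congr 1
    funext u
    by_cases hu : IsDistinguished s u
    · simp only [isDistinguished_cons, hu, and_true, if_true, one_mul]
      rw [tsum_eq_sum (s := Finset.range s) fun i hi => if_neg fun h => hi (Finset.mem_range.2 h),
        Finset.sum_congr rfl fun i hi => if_pos (Finset.mem_range.1 hi)]
      simp
    · simp [isDistinguished_cons, hu]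

/-! ### Growth of the tree with truncated offspring numbers -/

/-- Offspring law of a distinguished individual in generation `n`. -/
def distinguishedLawAt (D : DegreeDist) (ρ : PMF ℕ) (n : ℕ) : PMF ℕ :=
  if n = 0 then ρ else D.distinguishedLaw

theorem offspringLaw_of_isDistinguished (D : DegreeDist) (ρ : PMF ℕ) {s : ℕ} {u : List ℕ}
    (hu : IsDistinguished s u) : offspringLaw D ρ s u = distinguishedLawAt D ρ u.length := by
  simp [offspringLaw, distinguishedLawAt, hu]

theorem offspringLaw_of_not_isDistinguished (D : DegreeDist) (ρ : PMF ℕ) {s : ℕ} {u : List ℕ}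
    (hu : ¬ IsDistinguished s u) : offspringLaw D ρ s u = D.ordinaryLaw := by
  simp [offspringLaw, hu]

/-- The numbers of children of `u` for which `u` has a child with label `i` and, if `u` is
distinguished, does not exceed the cutoff `c` for its generation. -/
def tameOffspring (c : ℕ → ℝ) (s : ℕ) (u : List ℕ) (i : ℕ) : Set ℕ :=
  {x | i < x ∧ (IsDistinguished s u → (x : ℝ) ≤ c u.length)}

/-- The individual is born, and the offspring numbers of its distinguished proper ancestors do not
exceed the cutoff `c`. -/
def IsTame (c : ℕ → ℝ) (s : ℕ) (ω : List ℕ → ℕ) : List ℕ → Prop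
  | [] => True
  | i :: u => ω u ∈ tameOffspring c s u i ∧ IsTame c s ω u

theorem isTame_iff_isBorn {c : ℕ → ℝ} {s : ℕ} {ω : List ℕ → ℕ}
    (h : ∀ u, IsDistinguished s u → (ω u : ℝ) ≤ c u.length) (v : List ℕ) :
    IsTame c s ω v ↔ IsBorn ω v := by
  induction v with
  | nil => exact Iff.rfl
  | cons i u ih =>
    rw [IsTame, IsBorn, ih]
    exact and_congr_left fun _ => ⟨fun h' => h'.1, fun h' => ⟨h', h u⟩⟩

theorem measurableSet_isTame (c : ℕ → ℝ) (s : ℕ) (v : List ℕ) :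
    MeasurableSet {ω | IsTame c s ω v} := by
  induction v with
  | nil => exact MeasurableSet.univ
  | cons i u ih =>
    exact ((measurable_pi_apply u) (MeasurableSet.of_discrete (s := tameOffspring c s u i))).inter ih

theorem setOf_isTame_cons_eq_pi {c : ℕ → ℝ} {s : ℕ} {v : List ℕ} {T : Finset (List ℕ)}
    {t : List ℕ → Set ℕ} (hv : v ∉ T) (h : {ω | IsTame c s ω v} = Set.pi T t) (i : ℕ) :
    {ω | IsTame c s ω (i :: v)} =
      Set.pi (insert v T : Finset (List ℕ)) (Function.update t v (tameOffspring c s v i)) := by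
  have hv' : v ∉ (T : Set (List ℕ)) := hv
  rw [Finset.coe_insert, Set.insert_pi, Function.update_self,
    Set.pi_update_of_notMem hv' t _ fun _ x => x, ← h]
  rfl

theorem setOf_isTame_eq_pi (c : ℕ → ℝ) (s : ℕ) (v : List ℕ) :
    ∃ (T : Finset (List ℕ)) (t : List ℕ → Set ℕ), (∀ u ∈ T, u.length < v.length) ∧
      {ω | IsTame c s ω v} = Set.pi T t := by
  induction v with
  | nil => exact ⟨∅, fun _ => Set.univ, by simp, by ext; simp [IsTame]⟩
  | cons i v ih =>
    obtain ⟨T, t, hT, h⟩ := ih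
    have hv : v ∉ T := fun hv => lt_irrefl _ (hT v hv)
    refine ⟨insert v T, Function.update t v (tameOffspring c s v i), ?_, ?_⟩
    · intro u hu
      rcases Finset.mem_insert.1 hu with rfl | hu
      · simp
      · exact (hT u hu).trans (by simp)
    · exact setOf_isTame_cons_eq_pi hv h i

/-- Tameness of `v` depends only on the offspring numbers of proper ancestors of `v`, hence is
independent of the offspring number of `v`. -/
theorem law_isTame_cons (D : DegreeDist) (ρ : PMF ℕ) (c : ℕ → ℝ) (s i : ℕ) (v : List ℕ) :
    law D ρ s {ω | IsTame c s ω (i :: v)} =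
      (offspringLaw D ρ s v).toMeasure (tameOffspring c s v i) * law D ρ s {ω | IsTame c s ω v} := by
  obtain ⟨T, t, hT, h⟩ := setOf_isTame_eq_pi c s v
  have hv : v ∉ T := fun hv => lt_irrefl _ (hT v hv)
  rw [setOf_isTame_cons_eq_pi hv h, h, law, Measure.infinitePi_pi _ fun _ _ => .of_discrete,
    Measure.infinitePi_pi _ fun _ _ => .of_discrete, Finset.prod_insert hv, Function.update_self]
  congr 1
  refine Finset.prod_congr rfl fun u hu => ?_
  rw [Function.update_of_ne (ne_of_mem_of_not_mem hu hv)]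

instance (D : DegreeDist) (ρ : PMF ℕ) (s : ℕ) : IsProbabilityMeasure (law D ρ s) := by
  unfold law
  infer_instance

theorem tsum_tameOffspring_of_isDistinguished (D : DegreeDist) (ρ : PMF ℕ) (c : ℕ → ℝ) {s : ℕ}
    {u : List ℕ} (hu : IsDistinguished s u) :
    ∑' i, (offspringLaw D ρ s u).toMeasure (tameOffspring c s u i) =
      truncatedMean (distinguishedLawAt D ρ u.length) (c u.length) := by
  rw [offspringLaw_of_isDistinguished D ρ hu, truncatedMean, ← tsum_toMeasure_lt_and]
  simp only [tameOffspring, hu, true_imp_iff]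

theorem tsum_tameOffspring_of_not_isDistinguished (D : DegreeDist) (ρ : PMF ℕ) (c : ℕ → ℝ) {s : ℕ}
    {u : List ℕ} (hu : ¬ IsDistinguished s u) :
    ∑' i, (offspringLaw D ρ s u).toMeasure (tameOffspring c s u i) =
      ENNReal.ofReal (D.a - 1) := by
  rw [offspringLaw_of_not_isDistinguished D ρ hu, ← D.tsum_mul_ordinaryLaw]
  have := tsum_toMeasure_lt_and D.ordinaryLaw fun _ => True
  simp only [if_true] at this
  rw [← this]
  simp only [tameOffspring, hu, false_imp_iff]

open Classical in
/-- The expected number of tame ordinary individuals in generation `n + 1`, split according to the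
type of the parent. -/
theorem levelSum_ordinary_succ_le (D : DegreeDist) (ρ : PMF ℕ) (c : ℕ → ℝ) (s n : ℕ) :
    levelSum (fun v => if IsDistinguished s v then 0 else law D ρ s {ω | IsTame c s ω v}) (n + 1) ≤
      levelSum (fun v => if IsDistinguished s v then 0 else law D ρ s {ω | IsTame c s ω v}) n *
        ENNReal.ofReal (D.a - 1) +
      (s : ℝ≥0∞) ^ n * truncatedMean (distinguishedLawAt D ρ n) (c n) := by
  rw [levelSum_succ]
  refine le_trans ?_ (add_le_add_right
    (mul_le_mul_left (levelSum_isDistinguished_le s n) _) _)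
  rw [← levelSum_mul_const, ← levelSum_mul_const, ← levelSum_add]
  refine levelSum_mono fun u hn => ?_
  calc ∑' i, (if IsDistinguished s (i :: u) then 0 else law D ρ s {ω | IsTame c s ω (i :: u)})
      ≤ ∑' i, (offspringLaw D ρ s u).toMeasure (tameOffspring c s u i) *
          law D ρ s {ω | IsTame c s ω u} := by
        refine ENNReal.tsum_le_tsum fun i => ?_
        split_ifs
        exacts [zero_le, (law_isTame_cons D ρ c s i u).le]
    _ = (∑' i, (offspringLaw D ρ s u).toMeasure (tameOffspring c s u i)) *
          law D ρ s {ω | IsTame c s ω u} := ENNReal.tsum_mul_right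
    _ ≤ _ := by
        by_cases hu : IsDistinguished s u
        · rw [tsum_tameOffspring_of_isDistinguished D ρ c hu, hn]
          simp only [hu, if_true, zero_mul, zero_add, one_mul]
          exact mul_le_of_le_one_right zero_le prob_le_one
        · rw [tsum_tameOffspring_of_not_isDistinguished D ρ c hu]
          simp [hu, mul_comm]

open Classical in
/-- The truncated tree grows at rate at most `3 m / 2`: there are at most `s ^ n` distinguished
individuals in generation `n`, and the number of ordinary ones is multiplied by at most `m` in
mean, up to immigration of order `(3 m / 2) ^ n` from distinguished parents. -/
theorem levelSum_isTame_le (D : DegreeDist) (ρ : PMF ℕ) {s : ℕ} {m C : ℝ≥0} (hm : 1 ≤ m)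
    (ha : D.a - 1 ≤ m) (hs : (s : ℝ≥0) ≤ m) {c : ℕ → ℝ}
    (hc : ∀ n, (s : ℝ≥0∞) ^ n * truncatedMean (distinguishedLawAt D ρ n) (c n) ≤
      C * ((3 / 2 * m : ℝ≥0) : ℝ≥0∞) ^ n) (n : ℕ) :
    levelSum (fun v => law D ρ s {ω | IsTame c s ω v}) n ≤
      (2 * C + 2 : ℝ≥0) * ((3 / 2 * m : ℝ≥0) : ℝ≥0∞) ^ n := by
  have hO : levelSum (fun v => if IsDistinguished s v then 0 else law D ρ s {ω | IsTame c s ω v}) n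
      ≤ (2 * C + 1 : ℝ≥0) * ((3 / 2 * m : ℝ≥0) : ℝ≥0∞) ^ n := by
    induction n with
    | zero =>
      rw [levelSum_zero, pow_zero, mul_one]
      have h1 : (1 : ℝ≥0∞) ≤ (2 * C + 1 : ℝ≥0) := by
        exact_mod_cast (le_add_self : (1 : ℝ≥0) ≤ 2 * C + 1)
      split_ifs
      exacts [zero_le, prob_le_one.trans h1]
    | succ n ih =>
      have ha' : ENNReal.ofReal (D.a - 1) ≤ m := by
        rw [← ENNReal.ofReal_coe_nnreal]
        exact ENNReal.ofReal_le_ofReal ha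
      refine (levelSum_ordinary_succ_le D ρ c s n).trans
        ((add_le_add (mul_le_mul' ih ha') (hc n)).trans ?_)
      have key : (2 * C + 1) * (3 / 2 * m) ^ n * m + C * (3 / 2 * m) ^ n ≤
          (2 * C + 1) * (3 / 2 * m) ^ (n + 1) := by
        rw [pow_succ]
        set r := (3 / 2 * m) ^ n
        rw [← NNReal.coe_le_coe]
        push_cast
        have h0 : (0 : ℝ) ≤ C * r * (m - 1) :=
          mul_nonneg (by positivity) (sub_nonneg.2 (by exact_mod_cast hm))
        have h1 : (0 : ℝ) ≤ r * m := by positivity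
        nlinarith
      exact_mod_cast key
  have hD : (s : ℝ≥0∞) ^ n ≤ ((3 / 2 * m : ℝ≥0) : ℝ≥0∞) ^ n := by
    gcongr
    have h2 : (s : ℝ≥0) ≤ 3 / 2 * m := by
      rw [← NNReal.coe_le_coe] at hs ⊢
      push_cast at hs ⊢
      linarith [m.2]
    exact_mod_cast h2
  -- Each distinguished label is counted with weight one, whether or not it is tame.
  have hsplit : levelSum (fun v => law D ρ s {ω | IsTame c s ω v}) n ≤
      levelSum (fun v => if IsDistinguished s v then 0 else law D ρ s {ω | IsTame c s ω v}) n +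
        levelSum (fun u => if IsDistinguished s u then 1 else 0) n := by
    rw [← levelSum_add]
    refine levelSum_mono fun v _ => ?_
    split_ifs
    · simpa using prob_le_one
    · simp
  refine hsplit.trans ((add_le_add hO ((levelSum_isDistinguished_le s n).trans hD)).trans
    (le_of_eq ?_))
  push_cast
  ring

open Classical in
/-- The generation sizes of the tame individuals, discounted by `(2 m)⁻¹` per generation, are
summable in mean, with ratio `(3 m / 2) (2 m)⁻¹ = 3 / 4`. -/
theorem ae_tsum_isTame_ne_top (D : DegreeDist) (ρ : PMF ℕ) {s : ℕ} {m C : ℝ≥0} (hm : 1 ≤ m)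
    (ha : D.a - 1 ≤ m) (hs : (s : ℝ≥0) ≤ m) {c : ℕ → ℝ}
    (hc : ∀ n, (s : ℝ≥0∞) ^ n * truncatedMean (distinguishedLawAt D ρ n) (c n) ≤
      C * ((3 / 2 * m : ℝ≥0) : ℝ≥0∞) ^ n) :
    ∀ᵐ ω ∂(law D ρ s),
      ∑' n, levelSum (fun v => if IsTame c s ω v then 1 else 0) n *
        (((2 * m)⁻¹ : ℝ≥0) : ℝ≥0∞) ^ n ≠ ∞ := by
  have hmeas : ∀ n v, Measurable fun ω : List ℕ → ℕ =>
      if v.length = n then (if IsTame c s ω v then (1 : ℝ≥0∞) else 0) else 0 := by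
    intro n v
    split_ifs
    · exact Measurable.ite (measurableSet_isTame c s v) measurable_const measurable_const
    · exact measurable_const
  have hmeas' : ∀ n, Measurable fun ω : List ℕ → ℕ =>
      levelSum (fun v => if IsTame c s ω v then 1 else 0) n := fun n =>
    Measurable.tsum fun v => hmeas n v
  have hint : ∀ n, ∫⁻ ω, levelSum (fun v => if IsTame c s ω v then 1 else 0) n ∂(law D ρ s) =
      levelSum (fun v => law D ρ s {ω | IsTame c s ω v}) n := by
    intro n
    simp_rw [levelSum]
    rw [lintegral_tsum fun v => (hmeas n v).aemeasurable]
    refine tsum_congr fun v => ?_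
    split_ifs
    · rw [← lintegral_indicator_one (measurableSet_isTame c s v)]
      refine lintegral_congr fun ω => ?_
      simp [Set.indicator_apply]
    · simp
  refine (ae_lt_top (Measurable.tsum fun n => (hmeas' n).mul_const _) ?_).mono
    fun ω h => h.ne
  rw [lintegral_tsum fun n => ((hmeas' n).mul_const _).aemeasurable]
  simp_rw [lintegral_mul_const _ (hmeas' _), hint]
  have hr : 3 / 2 * m * (2 * m)⁻¹ = 3 / 4 := by
    have : m ≠ 0 := (one_pos.trans_le hm).ne'
    field_simp
    norm_num
  have hle : ∀ n, levelSum (fun v => law D ρ s {ω | IsTame c s ω v}) n *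
      (((2 * m)⁻¹ : ℝ≥0) : ℝ≥0∞) ^ n ≤ (2 * C + 2 : ℝ≥0) * ((3 / 4 : ℝ≥0) : ℝ≥0∞) ^ n := by
    intro n
    refine (mul_le_mul_left (levelSum_isTame_le D ρ hm ha hs hc n) _).trans (le_of_eq ?_)
    rw [mul_assoc, ← mul_pow, ← ENNReal.coe_mul, hr]
  refine ne_top_of_le_ne_top ?_ (ENNReal.tsum_le_tsum hle)
  rw [ENNReal.tsum_mul_left, ENNReal.tsum_geometric]
  refine ENNReal.mul_ne_top ENNReal.coe_ne_top (ENNReal.inv_ne_top.2 ?_)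
  rw [← ENNReal.coe_one, ← ENNReal.coe_sub, ENNReal.coe_ne_zero, ← pos_iff_ne_zero, tsub_pos_iff_lt]
  rw [← NNReal.coe_lt_coe]
  norm_num

open Classical in
/-- By Borel–Cantelli, all but finitely many distinguished individuals have offspring number at most
`R ^ n`, where `n` is their generation; the constant `M` accounts for the others and the root. -/
theorem ae_exists_le_mul_pow (D : DegreeDist) (ρ : PMF ℕ) {s : ℕ} {R : ℝ} (hR : 1 ≤ R)
    (h : ∑' n : ℕ, (s : ℝ≥0∞) ^ n * D.distinguishedLaw.toMeasure {x : ℕ | R ^ n < x} ≠ ∞) :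
    ∀ᵐ ω ∂(law D ρ s), ∃ M : ℕ, ∀ u, IsDistinguished s u → (ω u : ℝ) ≤ M * R ^ u.length := by
  set A : List ℕ → Set (List ℕ → ℕ) := fun u =>
    {ω | u ≠ [] ∧ IsDistinguished s u ∧ R ^ u.length < ω u}
  have hA : ∀ u, law D ρ s (A u) ≤ (if IsDistinguished s u then 1 else 0) *
      D.distinguishedLaw.toMeasure {x : ℕ | R ^ u.length < x} := by
    intro u
    by_cases hu : u ≠ [] ∧ IsDistinguished s u
    · have h1 : A u = (fun ω => ω u) ⁻¹' {x : ℕ | R ^ u.length < x} := by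
        ext ω
        simp [A, hu.1, hu.2]
      rw [h1, ← Measure.map_apply (measurable_pi_apply u) .of_discrete, law,
        Measure.infinitePi_map_eval, offspringLaw_of_isDistinguished D ρ hu.2, distinguishedLawAt,
        if_neg fun h => hu.1 (List.length_eq_zero_iff.1 h), if_pos hu.2, one_mul]
    · have h1 : A u = ∅ := by
        ext ω
        simp only [A, Set.mem_ofPred_eq, Set.mem_empty_iff_false, iff_false]
        exact fun h => hu ⟨h.1, h.2.1⟩
      rw [h1, measure_empty]
      exact zero_le
  have hsum : ∑' u, law D ρ s (A u) ≠ ∞ := by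
    refine ne_top_of_le_ne_top h ((ENNReal.tsum_le_tsum hA).trans ?_)
    rw [← tsum_levelSum]
    refine ENNReal.tsum_le_tsum fun n => ?_
    refine le_trans ?_ (mul_le_mul_left (levelSum_isDistinguished_le s n) _)
    rw [← levelSum_mul_const]
    exact levelSum_mono fun u hu => by rw [hu]
  filter_upwards [ae_finite_setOfPred_mem hsum] with ω hfin
  set M := ω [] + ∑ u ∈ hfin.toFinset, ω u + 1
  refine ⟨M, fun u hu => ?_⟩
  have hpow : 1 ≤ R ^ u.length := one_le_pow₀ hR
  have hM1 : (1 : ℝ) ≤ M := by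
    simp only [M]
    push_cast
    linarith [(by positivity : (0 : ℝ) ≤ (ω [] : ℝ) + ∑ u ∈ hfin.toFinset, (ω u : ℝ))]
  by_cases hle : (ω u : ℝ) ≤ R ^ u.length
  · nlinarith
  · have hMu : ω u ≤ M := by
      by_cases hu0 : u = []
      · rw [hu0]
        simp only [M]
        omega
      · have : ω u ≤ ∑ u ∈ hfin.toFinset, ω u :=
          Finset.single_le_sum (f := ω) (fun _ _ => Nat.zero_le _)
            ((Set.Finite.mem_toFinset _).2 ⟨hu0, hu, not_le.1 hle⟩)
        simp only [M]
        omega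
    have : (ω u : ℝ) ≤ M := by exact_mod_cast hMu
    nlinarith

open Classical in
theorem card_sphere_le_levelSum (ω : List ℕ → ℕ) (n : ℕ) :
    ((finite_sphere ω n).toFinset.card : ℝ≥0∞) ≤
      levelSum (fun v => if IsBorn ω v then 1 else 0) n := by
  rw [← Finset.card_map (Function.Embedding.subtype _), Finset.card_eq_sum_ones, Nat.cast_sum]
  refine le_trans (Finset.sum_le_sum fun v hv => ?_) (ENNReal.sum_le_tsum _)
  obtain ⟨u, hu, rfl⟩ := Finset.mem_map.1 hv
  have h1 : u.1.length = n := mem_sphere.1 ((Set.Finite.mem_toFinset _).1 hu)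
  have h2 : IsBorn ω u.1 := u.2
  simp [h1, h2]

/-! ### The paramagnetic state -/

/-- If the offspring numbers of the distinguished individuals grow at most at rate `3 m / 2`, both
almost surely and in truncated mean, then couplings up to `1 / (4 m)` give a paramagnetic state. -/
theorem ae_isParamagnetic (D : DegreeDist) (ρ : PMF ℕ) {s : ℕ} {m : ℝ≥0} (hm : 1 ≤ m)
    (ha : D.a - 1 ≤ m) (hs : (s : ℝ≥0) ≤ m)
    (htail : ∑' n : ℕ, (s : ℝ≥0∞) ^ n *
      D.distinguishedLaw.toMeasure {x : ℕ | (3 / 2 * m : ℝ) ^ n < x} ≠ ∞)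
    (hmean : ∀ M : ℕ, ∃ C : ℝ≥0, ∀ n : ℕ,
      (s : ℝ≥0∞) ^ n * truncatedMean D.distinguishedLaw (M * (3 / 2 * m : ℝ) ^ n) ≤
        C * ((3 / 2 * m : ℝ≥0) : ℝ≥0∞) ^ n) :
    ∀ᵐ ω ∂(law D ρ s), ∀ J : Sym2 (Vertex ω) → ℝ,
      BddAbove (Set.range fun e : (tree ω).edgeSet => |J e|) → ∀ β : ℝ, 0 < β →
      Ising.couplingBound (tree ω) J β ≤ 1 / 4 * (1 / m) →
      Ising.IsParamagnetic (tree ω) (root ω) J β := by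
  classical
  have hmean' : ∀ M : ℕ, ∃ C : ℝ≥0, ∀ n : ℕ,
      (s : ℝ≥0∞) ^ n * truncatedMean (distinguishedLawAt D ρ n) (M * (3 / 2 * m : ℝ) ^ n) ≤
        C * ((3 / 2 * m : ℝ≥0) : ℝ≥0∞) ^ n := by
    intro M
    obtain ⟨C, hC⟩ := hmean M
    refine ⟨M + C, fun n => ?_⟩
    -- The law `ρ` of the root enters only for `n = 0`, where the cutoff `M` is a trivial bound.
    rcases Nat.eq_zero_or_pos n with rfl | hn
    · simp only [pow_zero, one_mul, mul_one]
      refine (truncatedMean_le _ _).trans ?_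
      rw [ENNReal.ofReal_natCast]
      push_cast
      exact le_self_add
    · rw [distinguishedLawAt, if_neg hn.ne']
      refine (hC n).trans (mul_le_mul_left ?_ _)
      push_cast
      exact le_add_self
  have hm' : (1 : ℝ) ≤ m := by exact_mod_cast hm
  have hall : ∀ᵐ ω ∂(law D ρ s), ∀ M : ℕ,
      ∑' n, levelSum (fun v => if IsTame (fun n => M * (3 / 2 * m : ℝ) ^ n) s ω v then 1 else 0) n *
        (((2 * m)⁻¹ : ℝ≥0) : ℝ≥0∞) ^ n ≠ ∞ := by
    rw [ae_all_iff]
    intro M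
    obtain ⟨C, hC⟩ := hmean' M
    exact ae_tsum_isTame_ne_top D ρ hm ha hs hC
  filter_upwards [hall, ae_exists_le_mul_pow D ρ (by linarith) htail] with ω hω hM J hJ β hβ hK
  obtain ⟨M, hM⟩ := hM
  have h0 := ENNReal.tendsto_atTop_zero_of_tsum_ne_top (hω M)
  simp only [isTame_iff_isBorn (c := fun n => M * (3 / 2 * m : ℝ) ^ n) hM] at h0
  have h1 : Tendsto (fun n => ((((2 * m)⁻¹ ^ n * (finite_sphere ω n).toFinset.card : ℝ≥0)) : ℝ≥0∞))
      atTop (𝓝 0) := by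
    refine tendsto_of_tendsto_of_tendsto_of_le_of_le tendsto_const_nhds h0 (fun n => zero_le)
      fun n => ?_
    dsimp only
    rw [mul_comm, ENNReal.coe_mul, ENNReal.coe_pow, ENNReal.coe_natCast]
    exact mul_le_mul_left (card_sphere_le_levelSum ω n) _
  rw [← ENNReal.coe_zero, ENNReal.tendsto_coe, ← NNReal.tendsto_coe] at h1
  push_cast at h1
  refine isParamagnetic_of_tendsto ω J hJ hβ (by positivity) ?_ h1
  calc 2 * Ising.couplingBound (tree ω) J β ≤ 2 * (1 / 4 * (1 / m)) := by gcongr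
    _ = (2 * (m : ℝ))⁻¹ := by
      field_simp
      norm_num

end GW

theorem DegreeDist.Kc_le (D : DegreeDist) : D.Kc ≤ 1 / 4 * (1 / (D.a - 1)) := by
  have ha := D.two_le_a
  have h1 : 0 < D.a - 1 := by linarith
  rw [DegreeDist.Kc]
  refine mul_le_mul_of_nonneg_left ?_ (by norm_num)
  refine (Real.log_le_sub_one_of_pos (by positivity)).trans (le_of_eq ?_)
  field_simp
  ring

theorem KcHat_le {s : ℕ} (hs : 0 < s) (α : ℝ) : KcHat s α ≤ 1 / 4 * (1 / (s : ℝ) ^ (1 / α)) := by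
  have h1 : 0 < (s : ℝ) ^ (1 / α) := by positivity
  rw [KcHat]
  refine mul_le_mul_of_nonneg_left ?_ (by norm_num)
  refine (Real.log_le_sub_one_of_pos (by positivity)).trans (le_of_eq ?_)
  field_simp
  ring

/-- With at most one distinguished individual per generation, no moment is needed for the
truncated means. -/
theorem pow_mul_truncatedMean_le (q : PMF ℕ) {s : ℕ} (hs : s ≤ 1) (m : ℝ≥0) (M n : ℕ) :
    (s : ℝ≥0∞) ^ n * truncatedMean q (M * (3 / 2 * m : ℝ) ^ n) ≤
      (M : ℝ≥0) * ((3 / 2 * m : ℝ≥0) : ℝ≥0∞) ^ n := by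
  have hs' : (s : ℝ≥0∞) ≤ 1 := by exact_mod_cast hs
  refine (mul_le_of_le_one_left zero_le (pow_le_one₀ zero_le hs')).trans
    ((truncatedMean_le _ _).trans (le_of_eq ?_))
  rw [← ENNReal.coe_pow, ← ENNReal.coe_mul, ← ENNReal.ofReal_coe_nnreal]
  push_cast
  rfl

end

theorem theorem1 (D : DegreeDist) (ρ : PMF ℕ)
    (hρ : ρ = D.distinguishedLaw ∨ ρ = D.sizeBiasedLaw) :
    (∀ᵐ ω ∂(GW.law D ρ 0), ∀ J : Sym2 (GW.Vertex ω) → ℝ,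
      BddAbove (Set.range fun e : (GW.tree ω).edgeSet => |J e|) → ∀ β : ℝ, 0 < β →
      Ising.couplingBound (GW.tree ω) J β < D.Kc →
      Ising.IsParamagnetic (GW.tree ω) (GW.root ω) J β) ∧
    (D.FiniteB →
      ∀ᵐ ω ∂(GW.law D ρ 1), ∀ J : Sym2 (GW.Vertex ω) → ℝ,
        BddAbove (Set.range fun e : (GW.tree ω).edgeSet => |J e|) → ∀ β : ℝ, 0 < β →
        Ising.couplingBound (GW.tree ω) J β < D.Kc →
        Ising.IsParamagnetic (GW.tree ω) (GW.root ω) J β) ∧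
    (∀ s : ℕ, 2 ≤ s → ∀ α : ℝ, 0 < α → α < 1 → D.FiniteBα s α →
      ∀ᵐ ω ∂(GW.law D ρ s), ∀ J : Sym2 (GW.Vertex ω) → ℝ,
        BddAbove (Set.range fun e : (GW.tree ω).edgeSet => |J e|) → ∀ β : ℝ, 0 < β →
        Ising.couplingBound (GW.tree ω) J β < min D.Kc (KcHat s α) →
        Ising.IsParamagnetic (GW.tree ω) (GW.root ω) J β) := by
  have ha := D.two_le_a
  have ha1 : (1 : ℝ) ≤ D.a - 1 := by linarith
  refine ⟨?_, fun hb => ?_, fun s hs α hα hα1 hbα => ?_⟩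
  · lift D.a - 1 to NNReal using by linarith with m hm
    have h := GW.ae_isParamagnetic D ρ (s := 0) (m := m) (by exact_mod_cast ha1) hm.ge (by simp)
      (by
        rw [tsum_eq_single 0 fun n hn => by simp [hn]]
        exact ENNReal.mul_ne_top (by simp) (measure_ne_top _ _))
      fun M => ⟨M, fun n => by
        exact_mod_cast pow_mul_truncatedMean_le D.distinguishedLaw zero_le_one m M n⟩
    filter_upwards [h] with ω hω J hJ β hβ hK
    exact hω J hJ β hβ (hK.le.trans (hm ▸ D.Kc_le))
  · lift D.a - 1 to NNReal using by linarith with m hm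
    have h := GW.ae_isParamagnetic D ρ (s := 1) (m := m) (by exact_mod_cast ha1) hm.ge
      (by exact_mod_cast ha1)
      (by
        simpa using tsum_tail_ne_top_of_log (R := 3 / 2 * m) (by linarith) hb.tsum_log_ne_top)
      fun M => ⟨M, fun n => pow_mul_truncatedMean_le D.distinguishedLaw le_rfl m M n⟩
    filter_upwards [h] with ω hω J hJ β hβ hK
    exact hω J hJ β hβ (hK.le.trans (hm ▸ D.Kc_le))
  · have hs1 : (1 : ℝ) ≤ s := by exact_mod_cast (by omega : 1 ≤ s)
    have hsα : (s : ℝ) ≤ (s : ℝ) ^ (1 / α) := by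
      conv_lhs => rw [← Real.rpow_one (s : ℝ)]
      exact Real.rpow_le_rpow_of_exponent_le hs1 ((one_le_div hα).2 hα1.le)
    have hmax0 : 0 ≤ max (D.a - 1) ((s : ℝ) ^ (1 / α)) := le_max_of_le_left (by linarith)
    obtain ⟨m, hm⟩ : ∃ m : NNReal, (m : ℝ) = max (D.a - 1) ((s : ℝ) ^ (1 / α)) :=
      ⟨⟨_, hmax0⟩, rfl⟩
    have hma : D.a - 1 ≤ m := hm ▸ le_max_left _ _
    have hms : (s : ℝ) ^ (1 / α) ≤ m := hm ▸ le_max_right _ _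
    have hmpos : (0 : ℝ) < m := by linarith
    -- The strict inequality makes the Borel–Cantelli series geometric with ratio below one.
    have hR : (s : ℝ) < (3 / 2 * m : ℝ) ^ α := by
      calc (s : ℝ) = ((s : ℝ) ^ (1 / α)) ^ α := by
            rw [← Real.rpow_mul (by positivity), one_div_mul_cancel hα.ne', Real.rpow_one]
        _ < (3 / 2 * m : ℝ) ^ α := Real.rpow_lt_rpow (by positivity) (by linarith) hα
    have hE := hbα.tsum_rpow_ne_top hα
    have h := GW.ae_isParamagnetic D ρ (s := s) (m := m)
      (by exact_mod_cast ha1.trans hma) hma (by exact_mod_cast hsα.trans hms)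
      (tsum_tail_ne_top_of_rpow (by positivity) hα hR hE)
      fun M => ⟨(ENNReal.ofReal ((M : ℝ) ^ (1 - α)) *
        ∑' x : ℕ, ENNReal.ofReal ((x : ℝ) ^ α) * D.distinguishedLaw x).toNNReal, fun n => by
          rw [ENNReal.coe_toNNReal (ENNReal.mul_ne_top ENNReal.ofReal_ne_top hE)]
          have := truncatedMean_le_of_rpow (q := D.distinguishedLaw) (by positivity) hα1 hR M n
          rwa [show ENNReal.ofReal (3 / 2 * m : ℝ) = ((3 / 2 * m : NNReal) : ENNReal) by
            rw [← ENNReal.ofReal_coe_nnreal]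
            push_cast
            rfl] at this⟩
    filter_upwards [h] with ω hω J hJ β hβ hK
    refine hω J hJ β hβ ?_
    rcases max_choice (D.a - 1) ((s : ℝ) ^ (1 / α)) with hc | hc
    · rw [hm, hc]
      exact (hK.le.trans (min_le_left _ _)).trans D.Kc_le
    · rw [hm, hc]
      exact (hK.le.trans (min_le_right _ _)).trans (KcHat_le (by omega) α)
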